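/- Let $m\ge 2$ have prime factorization $m=\prod_{i=1}^{h}p_i^{k_i}$, let $l,r\in\mathbb Z$ and let $a_l,\dots,a_r$ be integers. Let $f(x_l,\dots,x_r)=\sum_{j=l}^{r}a_jx_j \pmod m$, let $T$ be the cellular automaton $(Tx)_n=f(x_{n+l},\dots,x_{n+r})$ on $\mathbb Z_m^{\mathbb Z}$, let $\sigma$ be the shift, $(\sigma x)_n=x_{n+1}$, and let $\Phi^{(n,t)}=T^{t}\circ\sigma^{n}$ for $n\in\mathbb Z$, $t\in\mathbb Z_{\ge 0}$. For each $i$ let $f_{p_i}$ be the reduction of $f$ modulo $p_i^{k_i}$ and let $\Phi_{p_i}$ be the corresponding action on $\mathbb Z_{p_i^{k_i}}^{\mathbb Z}$, generated by the cellular automaton with local rule $f_{p_i}$ and the shift. Assume that for every $i$ the rule $f_{p_i}$ is left and right permutative, in the sense that it is permutative in some variable $x_j$ with $j\le 0$ and in some variable $x_{j'}$ with $j'\ge 0$. (A rule is permutative in $x_j$ if it is a bijection as a function of $x_j$ for any fixed values of the other variables.) For $\theta\in[0,\pi]$ define the topological directional entropy of $\Phi$ by $$h_\theta(\Phi)=\lim_{\varepsilon\to0^+}\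 \limsup_{w\to\infty}\ \limsup_{T\to\infty}\ \frac1T\log N(\varepsilon,W(w,T,\theta)),$$ where $W(w,T,\theta)=\{(x+y\cos\theta,\;y\sin\theta): -w<x<w,\ 0<y\le T\}$ and $N(\varepsilon,W)$ is the largest cardinality of a set $M$ of configurations such that for any two distinct $x,\bar x\in M$ there is an integer point $(n,t)\in W$ with $d(\Phi^{(n,t)}x,\Phi^{(n,t)}\bar x)\ge\varepsilon$. Here $d(x,y)=\sum_{i\in\mathbb Z}|x_i-y_i|\,m^{-|i|}$, with states read as $0,\dots,m-1$. Define $h_\theta(\Phi_{p_i})$ in the same way, with $p_i^{k_i}$ in place of $m$. Put $P_i=\{0\}\cup\{j\in[l,r]:\gcd(a_j,p_i)=1\}$, $L_i=\min P_i$, $R_i=\max P_i$, $\theta_{L_i}=\operatorname{arccot}(-L_i)$ and $\theta_{R_i}=\operatorname{arccot}(-R_i)$, where $\operatorname{arccot}$ takes values in $(0,\pi)$; thus $\theta_{L_i}\le\theta_{R_i}$. Then for every $\theta\in[0,\pi]$ $$h_\theta(\Phi)=\sum_{i=1}^{h}h_\theta(\Phi_{p_i})=\sum_{i=1}^{h}g_i(\theta),$$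 where $$g_i(\theta)=\begin{cases}k_i\,|\cos\theta+R_i\sin\theta|\,\log p_i,&\theta\in[0,\theta_{L_i}],\\ k_i\,|(R_i-L_i)\sin\theta|\,\log p_i,&\theta\in[\theta_{L_i},\theta_{R_i}],\\ k_i\,|\cos\theta+L_i\sin\theta|\,\log p_i,&\theta\in[\theta_{R_i},\pi],\end{cases}$$ and the pieces agree at common endpoints. Equivalently, whenever $\{1,\dots,h\}$ is a disjoint union $A\cup B\cup C$ such that $\theta\le\theta_{L_i}$ for $i\in A$, $\theta_{L_i}\le\theta\le\theta_{R_i}$ for $i\in B$, and $\theta_{R_i}\le\theta$ for $i\in C$, $$h_\theta(\Phi)=\sum_{i\in A}k_i|\cos\theta+R_i\sin\theta|\log p_i+\sum_{i\in B}k_i|(R_i-L_i)\sin\theta|\log p_i+\sum_{i\in C}k_i|\cos\theta+L_i\sin\theta|\log p_i .$$ In particular, $h_\theta(\Phi)=\sum_i k_i|\cos\theta+R_i\sin\theta|\log p_i$ on $[0,\min_j\theta_{L_j}]$ and $h_\theta(\Phi)=\sum_i k_i|\cos\theta+L_i\sin\theta|\log p_i$ on $[\max_j\theta_{R_j},\pi]$.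 -/

import Mathlib

open Filter Topology

noncomputable section

namespace LCA

/-! ### Linear cellular automata over `ZMod m` and the action they generate with the shift -/

/-- A local rule `f : A ^ ι → A` is permutative in the variable `j` if, whatever the values of the
other variables are, `f` is a bijection of `A` as a function of the `j`-th variable. -/
def PermutativeIn {ι A : Type*} [DecidableEq ι] (f : (ι → A) → A) (j : ι) : Prop :=
  ∀ x : ι → A, Function.Bijective fun c : A => f (Function.update x j c)

/-- The linear local rule `f (x_l, …, x_r) = ∑_{i = l}^r a_i x_i (mod m)`. Its reduction modulo a
divisor `d` of `m` is `localRule d l r a`. -/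
def localRule (m : ℕ) (l r : ℤ) (a : ℤ → ℤ) (x : Finset.Icc l r → ZMod m) : ZMod m :=
  ∑ i : Finset.Icc l r, (a i : ZMod m) * x i

/-- The one-dimensional cellular automaton `(T x)_n = f (x_{n+l}, …, x_{n+r})`. -/
def automaton (m : ℕ) (l r : ℤ) (a : ℤ → ℤ) (x : ℤ → ZMod m) : ℤ → ZMod m :=
  fun n => localRule m l r a fun i => x (n + i)

/-- The power `σ ^ u` of the shift: `(σ ^ u x)_n = x_{n+u}`. -/
def shift {A : Type*} (u : ℤ) (x : ℤ → A) : ℤ → A := fun n => x (n + u)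

/-- The action `Φ^{(u,s)} = T ^ s ∘ σ ^ u` generated by the automaton and the shift. -/
def action (m : ℕ) (l r : ℤ) (a : ℤ → ℤ) (q : ℤ × ℕ) (x : ℤ → ZMod m) : ℤ → ZMod m :=
  (automaton m l r a)^[q.2] (shift q.1 x)

/-- The metric `d(x, y) = ∑_i |x_i - y_i| / m^|i|` on configurations, the states being read as
`0, …, m - 1`. -/
def configDist (m : ℕ) (x y : ℤ → ZMod m) : ℝ :=
  ∑' i : ℤ, |((x i).val : ℝ) - ((y i).val : ℝ)| / (m : ℝ) ^ i.natAbs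

/-! ### Topological directional entropy -/

/-- The lattice points, with nonnegative time coordinate, of the parallelogram
`{(x + y cos θ, y sin θ) : -w < x < w, 0 < y ≤ T}`. -/
def window (w T θ : ℝ) : Set (ℤ × ℕ) :=
  {q | ∃ x y : ℝ, -w < x ∧ x < w ∧ 0 < y ∧ y ≤ T ∧
    (q.1 : ℝ) = x + y * Real.cos θ ∧ (q.2 : ℝ) = y * Real.sin θ}

/-- Any two distinct points of `M` are moved at distance at least `ε` by some `Φ^{(n,t)}` with
`(n, t)` in `W`. -/
def IsSeparated {X : Type*} (d : X → X → ℝ) (Φ : ℤ × ℕ → X → X) (ε : ℝ) (W : Set (ℤ × ℕ))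
    (M : Set X) : Prop :=
  ∀ x ∈ M, ∀ y ∈ M, x ≠ y → ∃ q ∈ W, ε ≤ d (Φ q x) (Φ q y)

/-- The largest cardinality of an `(ε, W)`-separated set. -/
def sepNumber {X : Type*} (d : X → X → ℝ) (Φ : ℤ × ℕ → X → X) (ε : ℝ) (W : Set (ℤ × ℕ)) : ℕ∞ :=
  ⨆ (M : Set X) (_ : IsSeparated d Φ ε W M), M.encard

/-- Topological directional entropy of `Φ` in the direction `(cos θ, sin θ)`:
`lim_{ε → 0} limsup_{w → ∞} limsup_{T → ∞} (1 / T) log N(ε, W(w, T, θ))`, with values in `[-∞, ∞]`.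
As `N` is nonincreasing in `ε`, the upper limit over `ε → 0+` is a limit. -/
def topDirEntropy {X : Type*} (d : X → X → ℝ) (Φ : ℤ × ℕ → X → X) (θ : ℝ) : EReal :=
  limsup (fun ε : ℝ =>
    limsup (fun w : ℝ =>
      limsup (fun T : ℝ =>
        ENNReal.log ((sepNumber d Φ ε (window w T θ) : ℕ∞) : ENNReal) / (T : EReal))
      atTop) atTop) (𝓝[>] 0)

/-- The topological directional entropy of the action on `(ZMod m) ^ ℤ` generated by the shift and
the linear automaton with coefficients `a_l, …, a_r`. -/
def dirEntropy (m : ℕ) (l r : ℤ) (a : ℤ → ℤ) (θ : ℝ) : EReal :=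
  topDirEntropy (configDist m) (action m l r a) θ

/-! ### The explicit formula -/

/-- `P = {0} ∪ {j ∈ [l, r] : gcd (a_j, p) = 1}`. -/
def unitIndices (l r : ℤ) (a : ℤ → ℤ) (p : ℕ) : Finset ℤ :=
  insert 0 ((Finset.Icc l r).filter fun j => Int.gcd (a j) p = 1)

/-- `L = min P`. -/
def leftIndex (l r : ℤ) (a : ℤ → ℤ) (p : ℕ) : ℤ :=
  (unitIndices l r a p).min' (Finset.insert_nonempty _ _)

/-- `R = max P`. -/
def rightIndex (l r : ℤ) (a : ℤ → ℤ) (p : ℕ) : ℤ :=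
  (unitIndices l r a p).max' (Finset.insert_nonempty _ _)

/-- The inverse cotangent with values in `(0, π)`. -/
def arccot (x : ℝ) : ℝ := Real.pi / 2 - Real.arctan x

/-- The three-piece function of `θ ∈ [0, π]` attached to a prime power `p ^ k` and to the extreme
indices `L ≤ R`; the pieces are `[0, arccot (-L)]`, `[arccot (-L), arccot (-R)]` and
`[arccot (-R), π]`. -/
def sectorTerm (p k : ℕ) (L R : ℤ) (θ : ℝ) : ℝ :=
  if θ ≤ arccot (-(L : ℝ)) then
    (k : ℝ) * |Real.cos θ + (R : ℝ) * Real.sin θ| * Real.log (p : ℝ)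
  else if θ ≤ arccot (-(R : ℝ)) then
    (k : ℝ) * |((R : ℝ) - (L : ℝ)) * Real.sin θ| * Real.log (p : ℝ)
  else
    (k : ℝ) * |Real.cos θ + (L : ℝ) * Real.sin θ| * Real.log (p : ℝ)

end LCA

end

noncomputable section

namespace LCA

/-! ### Linear rules as linear maps -/

/-! The automaton is linear, so counting separated orbits becomes counting sites. By the Chinese
remainder theorem each prime power `p ^ k` is treated alone. Two kinds of finite sets of sites
matter. If `J` satisfies `Determines`, the values on `J` fix all that is seen through the window,
which bounds separated sets from above (`exists_sepNumber_le`). If `J` satisfies `Detects`,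
configurations supported in `J` are told apart through the window, which gives a bound from below
(`le_sepNumber`). It remains to find both kinds with `T * sectorWidth L M θ + O(1)` sites, where `L
≤ M` are the extreme indices.

From time `t` and site `n`, the domain of dependence is essentially `[n + L t, n + M t]`.
Coefficients outside `[L, M]` are divisible by `p`, so fewer than `k` of them enter a nonzero
product, and they widen the domain by a bounded amount only (`correlation_pow_eq_zero`). Along
direction `θ` its ends move at speeds `cos θ + L sin θ` and `cos θ + M sin θ`; the region swept in
time `T` has length `T * sectorWidth L M θ` up to a constant, which is the upper bound.

For the lower bound, the coefficients at `L` and `M` are units by permutativity, so swept sites can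
be solved for one at a time from the ends (`exists_detects`). Multiplying by a power of `p` reduces
detection to the rule cut down to `[L, M]` (`Detects.of_dvd`). The three sectors record the signs of
the two speeds. -/

/-- The linear map `z ↦ (n ↦ ∑_{j ∈ s} a_j z_{n+j})`. -/
def correlation {R : Type*} [CommRing R] (s : Finset ℤ) (a : ℤ → R) : (ℤ → R) →ₗ[R] (ℤ → R) where
  toFun z n := ∑ j ∈ s, a j * z (n + j)
  map_add' x y := by
    ext n
    simp [mul_add, Finset.sum_add_distrib]
  map_smul' c x := by
    ext n
    simp only [Pi.smul_apply, smul_eq_mul, RingHom.id_apply, Finset.mul_sum]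
    exact Finset.sum_congr rfl fun j _ => by ring

section Correlation

variable {R : Type*} [CommRing R]

theorem correlation_apply (s : Finset ℤ) (a z : ℤ → R) (n : ℤ) :
    correlation s a z n = ∑ j ∈ s, a j * z (n + j) := rfl

theorem correlation_pow_succ (s : Finset ℤ) (a z : ℤ → R) (t : ℕ) :
    (correlation s a ^ (t + 1)) z = (correlation s a ^ t) (correlation s a z) := by
  rw [pow_succ]
  rfl

theorem correlation_pow_shift (s : Finset ℤ) (a : ℤ → R) (t : ℕ) (u : ℤ) (z : ℤ → R) (n : ℤ) :
    (correlation s a ^ t) (shift u z) n = (correlation s a ^ t) z (n + u) := by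
  induction t generalizing z with
  | zero => rfl
  | succ t ih =>
    rw [correlation_pow_succ, correlation_pow_succ, ← ih]
    refine congrArg (fun w => (correlation s a ^ t) w n) (funext fun i => ?_)
    simp only [correlation_apply, shift]
    exact Finset.sum_congr rfl fun j _ => by rw [add_right_comm]

theorem correlation_pow_map {S : Type*} [CommRing S] (φ : R →+* S) (s : Finset ℤ) (a : ℤ → R)
    (t : ℕ) (z : ℤ → R) (n : ℤ) :
    φ ((correlation s a ^ t) z n) = (correlation s (φ ∘ a) ^ t) (φ ∘ z) n := by
  induction t generalizing z with
  | zero => rfl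
  | succ t ih =>
    rw [correlation_pow_succ, correlation_pow_succ, ih]
    refine congrArg (fun w => (correlation s (φ ∘ a) ^ t) w n) (funext fun i => ?_)
    simp [correlation_apply]

theorem correlation_pow_comp_neg (s : Finset ℤ) (a : ℤ → R) (t : ℕ) (z : ℤ → R) :
    (correlation (s.map (Equiv.neg ℤ).toEmbedding) (a ∘ Neg.neg) ^ t) (z ∘ Neg.neg) =
      (correlation s a ^ t) z ∘ Neg.neg := by
  induction t generalizing z with
  | zero => rfl
  | succ t ih =>
    rw [correlation_pow_succ, correlation_pow_succ, ← ih]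
    congr 1
    ext i
    simp [correlation_apply, add_comm]

theorem correlation_filter_add (s : Finset ℤ) (q : ℤ → Prop) [DecidablePred q] (a z : ℤ → R) :
    correlation s a z =
      correlation (s.filter q) a z + correlation (s.filter fun j => ¬ q j) a z := by
  ext n
  exact (Finset.sum_filter_add_sum_filter_not s q _).symm

/-- If `p` divides all coefficients outside `[L, M]` and `p ^ k` kills `z`, then the `t`-th iterate
at `n` depends only on the values of `z` on `[n + L t - k D, n + M t + k D]`. -/
theorem correlation_pow_eq_zero (s : Finset ℤ) (a : ℤ → R) (p : R) (L M D : ℤ) (hD0 : 0 ≤ D)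
    (ha : ∀ j ∈ s, ¬ (L ≤ j ∧ j ≤ M) → p ∣ a j)
    (hD : ∀ j ∈ s, L - D ≤ j ∧ j ≤ M + D) (t k : ℕ) (z : ℤ → R) (hz : p ^ k • z = 0) (n : ℤ)
    (h0 : ∀ i, n + L * t - k * D ≤ i → i ≤ n + M * t + k * D → z i = 0) :
    (correlation s a ^ t) z n = 0 := by
  induction t generalizing k z with
  | zero => exact h0 n (by push_cast; nlinarith) (by push_cast; nlinarith)
  | succ t ih =>
    rw [correlation_pow_succ, correlation_filter_add s (fun j => L ≤ j ∧ j ≤ M), map_add,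
      Pi.add_apply]
    have h1 : (correlation s a ^ t)
        (correlation (s.filter fun j => L ≤ j ∧ j ≤ M) a z) n = 0 := by
      refine ih k _ (by rw [← map_smul, hz, map_zero]) fun i hi1 hi2 => ?_
      refine Finset.sum_eq_zero fun j hj => ?_
      obtain ⟨-, hj1, hj2⟩ := Finset.mem_filter.1 hj
      rw [h0 (i + j) (by push_cast; linarith) (by push_cast; linarith), mul_zero]
    -- Each use of a coefficient divisible by `p` lowers the exponent killing the configuration by
    -- one, which pays for the extra displacement `D`.
    have h2 : (correlation s a ^ t)
        (correlation (s.filter fun j => ¬ (L ≤ j ∧ j ≤ M)) a z) n = 0 := by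
      cases k with
      | zero =>
        have : z = 0 := by simpa using hz
        simp [this]
      | succ k =>
        refine ih k _ ?_ fun i hi1 hi2 => ?_
        · ext i
          simp only [Pi.smul_apply, smul_eq_mul, Pi.zero_apply, correlation_apply, Finset.mul_sum]
          refine Finset.sum_eq_zero fun j hj => ?_
          obtain ⟨hj, hj1⟩ := Finset.mem_filter.1 hj
          obtain ⟨b, hb⟩ := ha j hj hj1
          have hzi : p ^ (k + 1) * z (i + j) = 0 := congrFun hz (i + j)
          rw [hb]
          linear_combination b * hzi
        · refine Finset.sum_eq_zero fun j hj => ?_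
          obtain ⟨hj1, hj2⟩ := hD j (Finset.mem_filter.1 hj).1
          rw [h0 (i + j) (by push_cast; linarith) (by push_cast; linarith), mul_zero]
    rw [h1, h2, add_zero]

/-- On configurations killed by `p`, only the coefficients not divisible by `p` matter. -/
theorem correlation_pow_eq_of_smul_eq_zero (s s' : Finset ℤ) (hs : s' ⊆ s) (a : ℤ → R) (p : R)
    (ha : ∀ j ∈ s, j ∉ s' → p ∣ a j) (t : ℕ) (z : ℤ → R) (hz : p • z = 0) :
    (correlation s a ^ t) z = (correlation s' a ^ t) z := by
  induction t generalizing z with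
  | zero => rfl
  | succ t ih =>
    have h : correlation s a z = correlation s' a z := by
      ext n
      refine (Finset.sum_subset hs fun j hj hj' => ?_).symm
      obtain ⟨b, hb⟩ := ha j hj hj'
      have hzi : p * z (n + j) = 0 := congrFun hz (n + j)
      rw [hb]
      linear_combination b * hzi
    rw [correlation_pow_succ, correlation_pow_succ, h, ih]
    rw [← map_smul, hz, map_zero]

/-! ### Rules whose extreme coefficients are units -/

/-- If `z` vanishes on `[n + L, n + M)`, only the rightmost term contributes. -/
theorem correlation_Icc_right (L M : ℤ) (hLM : L ≤ M) (a z : ℤ → R) (n : ℤ)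
    (h0 : ∀ i, n + L ≤ i → i < n + M → z i = 0) :
    correlation (Finset.Icc L M) a z n = a M * z (n + M) := by
  refine Finset.sum_eq_single_of_mem M (Finset.mem_Icc.2 ⟨hLM, le_rfl⟩) fun j hj hjM => ?_
  obtain ⟨h1, h2⟩ := Finset.mem_Icc.1 hj
  rw [h0 (n + j) (by omega) (by omega), mul_zero]

/-- The bound on the left edge of the support moves by `M` per step; at the edge only the term with
coefficient `a M` survives. -/
theorem correlation_pow_right (L M : ℤ) (hLM : L ≤ M) (a z : ℤ → R) (t : ℕ) (n : ℤ)
    (h0 : ∀ i, i < n + M * t → z i = 0) :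
    (correlation (Finset.Icc L M) a ^ t) z n = a M ^ t * z (n + M * t) := by
  induction t generalizing z with
  | zero => simp
  | succ t ih =>
    have h1 : ∀ i, i ≤ n + M * t →
        correlation (Finset.Icc L M) a z i = a M * z (i + M) := fun i hi =>
      correlation_Icc_right L M hLM a z i fun j _ hj => h0 j (by push_cast; linarith)
    rw [correlation_pow_succ, ih, h1 _ le_rfl, pow_succ, mul_assoc]
    · congr 3
      push_cast
      ring
    · intro i hi
      rw [h1 i hi.le, h0 (i + M) (by push_cast; linarith), mul_zero]

/-- If the iterates of `z` vanish on overlapping windows `[α_t, β_t]`, `t ≤ N`, then `z` vanishes up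
to `β_N + M N` on the right. -/
theorem eq_zero_right_of_windows (L M : ℤ) (hLM : L ≤ M) (a : ℤ → R) (hM : IsUnit (a M)) (N : ℕ)
    (α β : ℕ → ℤ) (h1 : ∀ t, α (t + 1) ≤ β t + 1 - M) (h2 : ∀ t, α t ≤ β t + 1 - (M - L))
    (z : ℤ → R)
    (h0 : ∀ t ≤ N, ∀ i, α t ≤ i → i ≤ β t → (correlation (Finset.Icc L M) a ^ t) z i = 0)
    (i : ℤ) (hi1 : α 0 ≤ i) (hi2 : i ≤ β N + M * N) : z i = 0 := by
  induction N generalizing α β z i with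
  | zero => exact h0 0 le_rfl i hi1 (by simpa using hi2)
  | succ N ih =>
    have h3 : ∀ i, α 1 ≤ i → i ≤ β (N + 1) + M * N →
        correlation (Finset.Icc L M) a z i = 0 := by
      refine ih (fun t => α (t + 1)) (fun t => β (t + 1)) (fun t => h1 _) (fun t => h2 _) _ ?_
      intro t ht i hi1 hi2
      rw [← correlation_pow_succ]
      exact h0 (t + 1) (by omega) i hi1 hi2
    -- Zeros of `z` spread right one site at a time: for `i` just beyond the cleared range, `h2`
    -- keeps the other arguments of the rule at `i - M` inside that range, `h1` places `i - M` where
    -- the image vanishes, and the unit `a M` gives `z i = 0`.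
    have h4 : ∀ d : ℕ, ∀ i, α 0 ≤ i → i ≤ β 0 + d → i ≤ β (N + 1) + M * (N + 1) → z i = 0 := by
      intro d
      induction d with
      | zero => exact fun i hi1 hi2 _ => h0 0 (by omega) i hi1 (by simpa using hi2)
      | succ d ihd =>
        intro i hi1 hi2 hi3
        rcases le_or_gt i (β 0 + d) with h | h
        · exact ihd i hi1 h hi3
        have ha0 := h2 0
        have ha1 := h1 0
        have h5 := correlation_Icc_right L M hLM a z (i - M) fun j hj1 hj2 =>
          ihd j (by omega) (by push_cast at hi2; omega) (by omega)
        rw [h3 (i - M) (by simp only [zero_add] at ha1; omega) (by linarith),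
          sub_add_cancel] at h5
        exact (hM.mul_right_eq_zero).1 h5.symm
    exact h4 (i - β 0).toNat i hi1 (by omega) (by push_cast at hi2; exact hi2)

end Correlation

/-! ### Reflection, and solving from the ends of domains of dependence -/

section Correlation

variable {R : Type*} [CommRing R]

/-- Reflection exchanges the two extreme coefficients, so left-hand statements follow from
right-hand ones. -/
theorem correlation_pow_Icc_neg (L M : ℤ) (a : ℤ → R) (t : ℕ) (z : ℤ → R) (n : ℤ) :
    (correlation (Finset.Icc (-M) (-L)) (a ∘ Neg.neg) ^ t) (z ∘ Neg.neg) n =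
      (correlation (Finset.Icc L M) a ^ t) z (-n) := by
  have h : Finset.Icc (-M) (-L) = (Finset.Icc L M).map (Equiv.neg ℤ).toEmbedding := by
    ext i
    simp only [Finset.mem_Icc, Finset.mem_map_equiv, Equiv.neg_symm, Equiv.neg_apply]
    omega
  rw [h, correlation_pow_comp_neg]
  rfl

/-- Left analogue of `eq_zero_right_of_windows`. -/
theorem eq_zero_left_of_windows (L M : ℤ) (hLM : L ≤ M) (a : ℤ → R) (hL : IsUnit (a L)) (N : ℕ)
    (α β : ℕ → ℤ) (h1 : ∀ t, α t - 1 - L ≤ β (t + 1)) (h2 : ∀ t, α t ≤ β t + 1 - (M - L))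
    (z : ℤ → R)
    (h0 : ∀ t ≤ N, ∀ i, α t ≤ i → i ≤ β t → (correlation (Finset.Icc L M) a ^ t) z i = 0)
    (i : ℤ) (hi1 : α N + L * N ≤ i) (hi2 : i ≤ β 0) : z i = 0 := by
  have h := eq_zero_right_of_windows (-M) (-L) (by omega) (a ∘ Neg.neg) (by simpa using hL) N
    (fun t => - β t) (fun t => - α t) (fun t => by have := h1 t; omega)
    (fun t => by have := h2 t; omega) (z ∘ Neg.neg)
    (fun t ht i hi1 hi2 => by
      rw [correlation_pow_Icc_neg]
      exact h0 t ht _ (by omega) (by omega)) (-i) (by omega) (by linarith)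
  simpa using h

/-- If every `j ∈ [A, B]` is the right end of the domain of dependence of a site where an iterate of
`z` vanishes, and `z` vanishes to the left of `A`, then `z` vanishes up to `B`. -/
theorem eq_zero_of_right_ends (L M : ℤ) (hLM : L ≤ M) (a : ℤ → R) (hM : IsUnit (a M)) (A B : ℤ)
    (z : ℤ → R) (hz : ∀ i < A, z i = 0)
    (h0 : ∀ j, A ≤ j → j ≤ B → ∃ (t : ℕ) (n : ℤ), n + M * t = j ∧
      (correlation (Finset.Icc L M) a ^ t) z n = 0) (i : ℤ) (hi : i ≤ B) : z i = 0 := by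
  have key : ∀ d : ℕ, ∀ i < A + d, i ≤ B → z i = 0 := by
    intro d
    induction d with
    | zero => exact fun i hi _ => hz i (by simpa using hi)
    | succ d ih =>
      intro i hi1 hi2
      rcases lt_or_ge i (A + d) with h | h
      · exact ih i h hi2
      obtain ⟨t, n, hn, h3⟩ := h0 i (by omega) hi2
      rw [correlation_pow_right L M hLM a z t n fun j hj => ih j (by push_cast at hi1; omega)
        (by omega), hn] at h3
      exact ((hM.pow t).mul_right_eq_zero).1 h3
  exact key (i - A + 1).toNat i (by omega) hi

/-- Left analogue of `eq_zero_of_right_ends`. -/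
theorem eq_zero_of_left_ends (L M : ℤ) (hLM : L ≤ M) (a : ℤ → R) (hL : IsUnit (a L)) (A B : ℤ)
    (z : ℤ → R) (hz : ∀ i, B < i → z i = 0)
    (h0 : ∀ j, A ≤ j → j ≤ B → ∃ (t : ℕ) (n : ℤ), n + L * t = j ∧
      (correlation (Finset.Icc L M) a ^ t) z n = 0) (i : ℤ) (hi : A ≤ i) : z i = 0 := by
  have h := eq_zero_of_right_ends (-M) (-L) (by omega) (a ∘ Neg.neg) (by simpa using hL) (-B) (-A)
    (z ∘ Neg.neg) (fun i hi => hz _ (by omega)) (fun j hj1 hj2 => by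
      obtain ⟨t, n, hn, h3⟩ := h0 (-j) (by omega) (by omega)
      refine ⟨t, -n, by linarith, ?_⟩
      rw [correlation_pow_Icc_neg, neg_neg, h3]) (-i) (by omega)
  simpa using h

end Correlation

/-! ### Finding positions that are seen through a window -/

/-- The asymptotic width, per unit of `T`, of the domain of dependence of the window in direction
`θ`, for a rule with extreme indices `L ≤ M`. -/
def sectorWidth (L M : ℤ) (θ : ℝ) : ℝ :=
  max (Real.cos θ + M * Real.sin θ) 0 + max (-(Real.cos θ + L * Real.sin θ)) 0

/-- Integer times occur along the ray with bounded gaps: spacing `1 / sin θ`, or always time `0`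
when `sin θ = 0`. -/
theorem exists_time (θ : ℝ) (hθ : θ ∈ Set.Icc 0 Real.pi) :
    ∃ K : ℝ, 0 < K ∧ ∀ y₀ : ℝ, 0 ≤ y₀ → ∃ y, y₀ < y ∧ y ≤ y₀ + K ∧
      ∃ t : ℕ, (t : ℝ) = y * Real.sin θ := by
  rcases (Real.sin_nonneg_of_mem_Icc hθ).eq_or_lt with h | h
  · exact ⟨1, one_pos, fun y₀ _ => ⟨y₀ + 1, by linarith, le_rfl, 0, by simp [← h]⟩⟩
  · refine ⟨1 / Real.sin θ, by positivity, fun y₀ hy => ?_⟩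
    have h1 := Nat.floor_le (mul_nonneg hy h.le)
    have h2 := Nat.lt_floor_add_one (y₀ * Real.sin θ)
    refine ⟨(⌊y₀ * Real.sin θ⌋₊ + 1 : ℕ) / Real.sin θ, ?_, ?_, ⌊y₀ * Real.sin θ⌋₊ + 1, ?_⟩
    · rw [lt_div_iff₀ h]
      push_cast
      exact h2
    · rw [div_le_iff₀ h, add_mul, one_div, inv_mul_cancel₀ h.ne']
      push_cast
      linarith
    · rw [div_mul_cancel₀ _ h.ne']

/-- `J` is a set of positions such that a configuration supported in `J` whose orbit vanishes on
the lattice points of `W` is zero. -/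
def Detects {R : Type*} [CommRing R] (s : Finset ℤ) (a : ℤ → R) (W : Set (ℤ × ℕ))
    (J : Finset ℤ) : Prop :=
  ∀ z : ℤ → R, (∀ i, i ∉ J → z i = 0) → (∀ q ∈ W, (correlation s a ^ q.2) z q.1 = 0) → z = 0

section Detects

variable {R : Type*} [CommRing R]

theorem detects_empty (s : Finset ℤ) (a : ℤ → R) (W : Set (ℤ × ℕ)) : Detects s a W ∅ :=
  fun _ hz _ => funext fun i => hz i (Finset.notMem_empty i)

theorem le_card_Icc (A B : ℤ) : (B : ℝ) + 1 - A ≤ (Finset.Icc A B).card := by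
  have : B + 1 - A ≤ ((B + 1 - A).toNat : ℤ) := Int.self_le_toNat _
  rw [Int.card_Icc]
  exact_mod_cast this

/-- The right end of the domain of dependence moves right at speed `α`. Gaps between integer times
shift it by at most `K * α`, which the width of the window absorbs, so every site of `J` is such an
end. -/
theorem exists_detects_right (L M : ℤ) (hLM : L ≤ M) (a : ℤ → R) (hM : IsUnit (a M)) (θ : ℝ)
    (hθ : θ ∈ Set.Icc 0 Real.pi) (hα : 0 < Real.cos θ + M * Real.sin θ) :
    ∃ w₀ C : ℝ, ∀ w ≥ w₀, ∀ T : ℝ, ∃ J : Finset ℤ,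
      T * (Real.cos θ + M * Real.sin θ) - C ≤ J.card ∧
      Detects (Finset.Icc L M) a (window w T θ) J := by
  set α := Real.cos θ + M * Real.sin θ with hαdef
  obtain ⟨K, hK, hK'⟩ := exists_time θ hθ
  refine ⟨K * α + 1, K * α, fun w hw T => ⟨Finset.Icc 0 ⌊(T - K) * α⌋, ?_, ?_⟩⟩
  · refine le_trans ?_ (le_card_Icc _ _)
    have := Int.lt_floor_add_one ((T - K) * α)
    push_cast
    linarith
  · intro z hz h0
    have key := eq_zero_of_right_ends L M hLM a hM 0 ⌊(T - K) * α⌋ z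
      (fun i hi => hz i fun h => absurd (Finset.mem_Icc.1 h).1 (by omega)) ?_
    · ext i
      rcases le_or_gt i ⌊(T - K) * α⌋ with h | h
      · exact key i h
      · exact hz i fun h' => absurd (Finset.mem_Icc.1 h').2 (by omega)
    · intro j hj1 hj2
      have hj1' : (0 : ℝ) ≤ j := by exact_mod_cast hj1
      have hj2' : (j : ℝ) ≤ (T - K) * α := Int.le_floor.1 hj2
      obtain ⟨y, hy1, hy2, t, ht⟩ := hK' (j / α) (by positivity)
      -- The offset `x = j - y * α` makes the right end exactly `j`; it lies in `[-K * α, 0)`.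
      refine ⟨t, j - M * t, by ring, h0 (j - M * t, t) ⟨j - y * α, y, ?_, ?_, ?_, ?_, ?_, ht⟩⟩
      · have : y * α ≤ (j / α + K) * α := mul_le_mul_of_nonneg_right hy2 hα.le
        rw [add_mul, div_mul_cancel₀ _ hα.ne'] at this
        linarith
      · have : j / α * α < y * α := mul_lt_mul_of_pos_right hy1 hα
        rw [div_mul_cancel₀ _ hα.ne'] at this
        nlinarith
      · exact lt_of_le_of_lt (by positivity) hy1
      · have : j / α ≤ T - K := (div_le_iff₀ hα).2 hj2'
        linarith
      · push_cast
        rw [ht, hαdef]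
        ring

theorem exists_detects_left (L M : ℤ) (hLM : L ≤ M) (a : ℤ → R) (hL : IsUnit (a L)) (θ : ℝ)
    (hθ : θ ∈ Set.Icc 0 Real.pi) (hβ : 0 < -(Real.cos θ + L * Real.sin θ)) :
    ∃ w₀ C : ℝ, ∀ w ≥ w₀, ∀ T : ℝ, ∃ J : Finset ℤ,
      T * -(Real.cos θ + L * Real.sin θ) - C ≤ J.card ∧
      Detects (Finset.Icc L M) a (window w T θ) J := by
  set γ := -(Real.cos θ + L * Real.sin θ) with hγdef
  obtain ⟨K, hK, hK'⟩ := exists_time θ hθ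
  refine ⟨K * γ + 1, K * γ, fun w hw T => ⟨Finset.Icc (-⌊(T - K) * γ⌋) 0, ?_, ?_⟩⟩
  · refine le_trans ?_ (le_card_Icc _ _)
    have := Int.lt_floor_add_one ((T - K) * γ)
    push_cast
    linarith
  · intro z hz h0
    have key := eq_zero_of_left_ends L M hLM a hL (-⌊(T - K) * γ⌋) 0 z
      (fun i hi => hz i fun h => absurd (Finset.mem_Icc.1 h).2 (by omega)) ?_
    · ext i
      rcases le_or_gt (-⌊(T - K) * γ⌋) i with h | h
      · exact key i h
      · exact hz i fun h' => absurd (Finset.mem_Icc.1 h').1 (by omega)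
    · intro j hj1 hj2
      have hj2' : (0 : ℝ) ≤ -j := by exact_mod_cast neg_nonneg.2 hj2
      have hj1' : (-j : ℝ) ≤ (T - K) * γ := by
        have := Int.le_floor.1 (show -j ≤ ⌊(T - K) * γ⌋ by omega)
        exact_mod_cast this
      obtain ⟨y, hy1, hy2, t, ht⟩ := hK' (-j / γ) (by positivity)
      refine ⟨t, j - L * t, by ring, h0 (j - L * t, t) ⟨j + y * γ, y, ?_, ?_, ?_, ?_, ?_, ht⟩⟩
      · have : -j / γ * γ < y * γ := mul_lt_mul_of_pos_right hy1 hβ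
        rw [div_mul_cancel₀ _ hβ.ne'] at this
        nlinarith
      · have : y * γ ≤ (-j / γ + K) * γ := mul_le_mul_of_nonneg_right hy2 hβ.le
        rw [add_mul, div_mul_cancel₀ _ hβ.ne'] at this
        linarith
      · exact lt_of_le_of_lt (by positivity) hy1
      · have : -j / γ ≤ T - K := (div_le_iff₀ hβ).2 hj1'
        linarith
      · push_cast
        rw [ht, hγdef]
        ring

/-- In the middle sector the whole strip of width `M - L` per row is seen. -/
theorem exists_detects_middle (L M : ℤ) (hLM : L ≤ M) (a : ℤ → R) (hL : IsUnit (a L))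
    (hM : IsUnit (a M)) (θ : ℝ) (hθ : 0 < Real.sin θ) :
    ∃ w₀ C : ℝ, ∀ w ≥ w₀, ∀ T : ℝ, ∃ J : Finset ℤ,
      T * ((M - L) * Real.sin θ) - C ≤ J.card ∧
      Detects (Finset.Icc L M) a (window w T θ) J := by
  set c := Real.cos θ / Real.sin θ with hc
  -- Row `t` of the window is centred at `t * c`. The half-width `V` exceeds the jump of the rounded
  -- centre plus the reach of the rule, so windows in consecutive rows overlap enough.
  set V : ℤ := |L| + |M| + ⌈|c|⌉ + 2 with hV
  have hML : (0 : ℝ) ≤ M - L := by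
    have : (L : ℝ) ≤ M := by exact_mod_cast hLM
    linarith
  have hstep : ∀ t : ℕ, |⌊((t + 1 : ℕ) : ℝ) * c⌋ - ⌊(t : ℝ) * c⌋| ≤ ⌈|c|⌉ + 1 := by
    intro t
    have h1 := Int.floor_le ((t : ℝ) * c)
    have h2 := Int.lt_floor_add_one ((t : ℝ) * c)
    have h3 := Int.floor_le (((t + 1 : ℕ) : ℝ) * c)
    have h4 := Int.lt_floor_add_one (((t + 1 : ℕ) : ℝ) * c)
    have h5 := Int.le_ceil |c|
    have h6 := abs_le.1 h5
    push_cast at h3 h4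
    rw [abs_le]
    constructor
    · have : (-(⌈|c|⌉ + 1 : ℤ) - 1 : ℝ) < (⌊((t + 1 : ℕ) : ℝ) * c⌋ - ⌊(t : ℝ) * c⌋ : ℤ) := by
        push_cast
        linarith
      have : (-(⌈|c|⌉ + 1) - 1 : ℤ) < ⌊((t + 1 : ℕ) : ℝ) * c⌋ - ⌊(t : ℝ) * c⌋ := by
        exact_mod_cast this
      omega
    · have : ((⌊((t + 1 : ℕ) : ℝ) * c⌋ - ⌊(t : ℝ) * c⌋ : ℤ) : ℝ) < ((⌈|c|⌉ + 1 : ℤ) : ℝ) := by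
        push_cast
        linarith
      have : (⌊((t + 1 : ℕ) : ℝ) * c⌋ - ⌊(t : ℝ) * c⌋ : ℤ) < ⌈|c|⌉ + 1 := by exact_mod_cast this
      omega
  have hc0 : 0 ≤ ⌈|c|⌉ := Int.ceil_nonneg (abs_nonneg c)
  refine ⟨V + 1, 2 * (M - L), fun w hw T => ?_⟩
  rcases lt_or_ge (T * Real.sin θ) 1 with hT | hT
  · exact ⟨∅, by simp only [Finset.card_empty, Nat.cast_zero]; nlinarith, detects_empty _ _ _⟩
  obtain ⟨N, hN⟩ : ∃ N, ⌊T * Real.sin θ⌋₊ = N + 1 :=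
    Nat.exists_eq_succ_of_ne_zero (Nat.floor_pos.2 hT).ne'
  have hN1 : (N : ℝ) + 1 ≤ T * Real.sin θ := by
    have := Nat.floor_le (show 0 ≤ T * Real.sin θ by linarith)
    rw [hN] at this
    exact_mod_cast this
  have hN2 : T * Real.sin θ < N + 2 := by
    have := Nat.lt_floor_add_one (T * Real.sin θ)
    rw [hN] at this
    push_cast at this
    linarith
  -- The window requires `y > 0` and so misses row `0`: the index `t + 1` makes these windows of
  -- iterates of the image of `z`, not of `z`.
  set α : ℕ → ℤ := fun t => ⌊((t + 1 : ℕ) : ℝ) * c⌋ - V with hα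
  set β : ℕ → ℤ := fun t => ⌊((t + 1 : ℕ) : ℝ) * c⌋ + V with hβ
  -- The image of `z` vanishes on `[α N + L * N, β N + M * N]`. The shift by `M` makes each site of
  -- `J` the right end of the dependence of one of these sites, so one more inversion recovers `z`.
  refine ⟨Finset.Icc (α N + L * N + M) (β N + M * N + M), ?_, fun z hz h0 => ?_⟩
  · refine le_trans ?_ (le_card_Icc _ _)
    have hVpos : (0 : ℝ) ≤ V := by
      have : 0 ≤ V := by positivity
      exact_mod_cast this
    simp only [hα, hβ]
    push_cast
    nlinarith
  · have habsL := abs_le.1 (le_refl |L|)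
    have habsM := abs_le.1 (le_refl |M|)
    have hrow : ∀ t ≤ N, ∀ i, α t ≤ i → i ≤ β t →
        (correlation (Finset.Icc L M) a ^ t) (correlation (Finset.Icc L M) a z) i = 0 := by
      intro t ht i hi1 hi2
      rw [← correlation_pow_succ]
      have h1 := Int.floor_le (((t + 1 : ℕ) : ℝ) * c)
      have h2 := Int.lt_floor_add_one (((t + 1 : ℕ) : ℝ) * c)
      have hi1' : ((⌊((t + 1 : ℕ) : ℝ) * c⌋ - V : ℤ) : ℝ) ≤ i := by exact_mod_cast hi1
      have hi2' : (i : ℝ) ≤ ((⌊((t + 1 : ℕ) : ℝ) * c⌋ + V : ℤ) : ℝ) := by exact_mod_cast hi2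
      push_cast [-Nat.cast_add, -Nat.cast_succ] at hi1' hi2'
      refine h0 (i, t + 1) ⟨i - ((t + 1 : ℕ) : ℝ) * c, ((t + 1 : ℕ) : ℝ) / Real.sin θ, ?_, ?_, ?_,
        ?_, ?_, ?_⟩
      · linarith
      · linarith
      · positivity
      · rw [div_le_iff₀ hθ]
        have : (t : ℝ) ≤ N := by exact_mod_cast ht
        push_cast
        linarith
      · rw [hc]
        ring
      · rw [div_mul_cancel₀ _ hθ.ne']
    have hst : ∀ t, |⌊((t + 1 + 1 : ℕ) : ℝ) * c⌋ - ⌊((t + 1 : ℕ) : ℝ) * c⌋| ≤ ⌈|c|⌉ + 1 :=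
      fun t => hstep (t + 1)
    have h2 : ∀ t, α t ≤ β t + 1 - (M - L) := fun t => by
      simp only [hα, hβ]
      omega
    have hright := eq_zero_right_of_windows L M hLM a hM N α β (fun t => by
      have := abs_le.1 (hst t)
      simp only [hα, hβ]
      omega) h2 _ hrow
    have hleft := eq_zero_left_of_windows L M hLM a hL N α β (fun t => by
      have := abs_le.1 (hst t)
      simp only [hα, hβ]
      omega) h2 _ hrow
    have hαβ : α 0 ≤ β 0 := by
      simp only [hα, hβ]
      omega
    have key := eq_zero_of_right_ends L M hLM a hM (α N + L * N + M) (β N + M * N + M) z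
      (fun i hi => hz i fun h => absurd (Finset.mem_Icc.1 h).1 (by omega)) fun j hj1 hj2 =>
        ⟨1, j - M, by simp, by
          rw [pow_one]
          rcases le_or_gt (α 0) (j - M) with h | h
          · exact hright _ h (by linarith)
          · exact hleft _ (by linarith) (by omega)⟩
    ext i
    rcases le_or_gt i (β N + M * N + M) with h | h
    · exact key i h
    · exact hz i fun h' => absurd (Finset.mem_Icc.1 h').2 (by omega)

theorem exists_detects (L M : ℤ) (hLM : L ≤ M) (a : ℤ → R) (hL : IsUnit (a L))
    (hM : IsUnit (a M)) (θ : ℝ) (hθ : θ ∈ Set.Icc 0 Real.pi) :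
    ∃ w₀ C : ℝ, ∀ w ≥ w₀, ∀ T : ℝ, ∃ J : Finset ℤ,
      T * sectorWidth L M θ - C ≤ J.card ∧ Detects (Finset.Icc L M) a (window w T θ) J := by
  have hs := Real.sin_nonneg_of_mem_Icc hθ
  have hLM' : (L : ℝ) * Real.sin θ ≤ M * Real.sin θ :=
    mul_le_mul_of_nonneg_right (by exact_mod_cast hLM) hs
  unfold sectorWidth
  rcases le_or_gt (Real.cos θ + M * Real.sin θ) 0 with h1 | h1 <;>
    rcases le_or_gt (-(Real.cos θ + L * Real.sin θ)) 0 with h2 | h2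
  · rw [max_eq_right h1, max_eq_right h2]
    exact ⟨0, 0, fun w _ T => ⟨∅, by simp, detects_empty _ _ _⟩⟩
  · rw [max_eq_right h1, max_eq_left h2.le, zero_add]
    exact exists_detects_left L M hLM a hL θ hθ h2
  · rw [max_eq_left h1.le, max_eq_right h2, add_zero]
    exact exists_detects_right L M hLM a hM θ hθ h1
  · rw [max_eq_left h1.le, max_eq_left h2.le]
    have hpos : 0 < Real.sin θ := by
      refine lt_of_le_of_ne hs fun h => ?_
      rw [← h] at h1 h2
      linarith
    rw [show Real.cos θ + M * Real.sin θ + -(Real.cos θ + L * Real.sin θ) =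
      (M - L) * Real.sin θ by ring]
    exact exists_detects_middle L M hLM a hL hM θ hpos

end Detects

/-! ### The sectors -/

/-- Since `arccot (-x) = π / 2 + arctan x`, the sign of the speed `cos θ + x sin θ` can be read off
from the side of `arccot (-x)` on which `θ` lies. -/
theorem cos_sub_arctan (x θ : ℝ) : Real.cos (θ - Real.arctan x) =
    Real.cos (Real.arctan x) * (Real.cos θ + x * Real.sin θ) := by
  have h : Real.sin (Real.arctan x) = x * Real.cos (Real.arctan x) := by
    have := Real.tan_mul_cos (Real.cos_arctan_pos x).ne'
    rw [Real.tan_arctan] at this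
    exact this.symm
  rw [Real.cos_sub, h]
  ring

theorem nonneg_of_le_arccot {x θ : ℝ} (hθ : θ ∈ Set.Icc 0 Real.pi) (h : θ ≤ arccot (-x)) :
    0 ≤ Real.cos θ + x * Real.sin θ := by
  rw [arccot, Real.arctan_neg] at h
  have h1 := Real.arctan_lt_pi_div_two x
  refine nonneg_of_mul_nonneg_right (b := Real.cos θ + x * Real.sin θ) ?_ (Real.cos_arctan_pos x)
  rw [← cos_sub_arctan]
  exact Real.cos_nonneg_of_mem_Icc ⟨by linarith [hθ.1], by linarith⟩

theorem nonpos_of_arccot_le {x θ : ℝ} (hθ : θ ∈ Set.Icc 0 Real.pi) (h : arccot (-x) ≤ θ) :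
    Real.cos θ + x * Real.sin θ ≤ 0 := by
  rw [arccot, Real.arctan_neg] at h
  have h1 := Real.neg_pi_div_two_lt_arctan x
  have h2 : Real.cos (θ - Real.arctan x) ≤ 0 :=
    Real.cos_nonpos_of_pi_div_two_le_of_le (by linarith) (by linarith [hθ.2])
  rw [cos_sub_arctan] at h2
  exact nonpos_of_mul_nonpos_right h2 (Real.cos_arctan_pos x)

section Sector

variable {L M : ℤ} {θ : ℝ}

theorem cos_add_le_cos_add (hLM : L ≤ M) (hθ : θ ∈ Set.Icc 0 Real.pi) :
    Real.cos θ + L * Real.sin θ ≤ Real.cos θ + M * Real.sin θ := by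
  have : (L : ℝ) * Real.sin θ ≤ M * Real.sin θ :=
    mul_le_mul_of_nonneg_right (by exact_mod_cast hLM) (Real.sin_nonneg_of_mem_Icc hθ)
  linarith

/-- This and the next two formulas evaluate one function on closed sectors, so the pieces agree at
common endpoints. -/
theorem sectorWidth_of_le_left (hLM : L ≤ M) (hθ : θ ∈ Set.Icc 0 Real.pi)
    (h : θ ≤ arccot (-(L : ℝ))) : sectorWidth L M θ = |Real.cos θ + M * Real.sin θ| := by
  have h1 := nonneg_of_le_arccot hθ h
  have h2 := h1.trans (cos_add_le_cos_add hLM hθ)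
  rw [sectorWidth, max_eq_left h2, max_eq_right (by linarith), add_zero, abs_of_nonneg h2]

theorem sectorWidth_of_mid (hθ : θ ∈ Set.Icc 0 Real.pi)
    (h : arccot (-(L : ℝ)) ≤ θ) (h' : θ ≤ arccot (-(M : ℝ))) :
    sectorWidth L M θ = |((M : ℝ) - L) * Real.sin θ| := by
  have h1 := nonpos_of_arccot_le hθ h
  have h2 := nonneg_of_le_arccot hθ h'
  rw [sectorWidth, max_eq_left h2, max_eq_left (by linarith), abs_of_nonneg (by linarith)]
  ring

theorem sectorWidth_of_right_le (hLM : L ≤ M) (hθ : θ ∈ Set.Icc 0 Real.pi)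
    (h : arccot (-(M : ℝ)) ≤ θ) : sectorWidth L M θ = |Real.cos θ + L * Real.sin θ| := by
  have h1 := nonpos_of_arccot_le hθ h
  have h2 := (cos_add_le_cos_add hLM hθ).trans h1
  rw [sectorWidth, max_eq_right h1, max_eq_left (by linarith), zero_add, abs_of_nonpos h2]

theorem sectorTerm_eq (hLM : L ≤ M) (hθ : θ ∈ Set.Icc 0 Real.pi) (p k : ℕ) :
    sectorTerm p k L M θ = k * sectorWidth L M θ * Real.log p := by
  unfold sectorTerm
  split_ifs with h1 h2
  · rw [sectorWidth_of_le_left hLM hθ h1]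
  · rw [sectorWidth_of_mid hθ (not_le.1 h1).le h2]
  · rw [sectorWidth_of_right_le hLM hθ (not_le.1 h2).le]

end Sector

/-! ### Extreme indices -/

theorem isUnit_of_permutativeIn {m : ℕ} {l r : ℤ} {a : ℤ → ℤ} {j : Finset.Icc l r}
    (h : PermutativeIn (localRule m l r a) j) : IsUnit (a j : ZMod m) := by
  obtain ⟨c, hc⟩ := (h 0).surjective 1
  refine .of_mul_eq_one c ?_
  rw [← hc]
  dsimp only
  rw [localRule, Finset.sum_eq_single j]
  · simp
  · intro i _ hij
    simp [Function.update_of_ne hij]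
  · simp

section Indices

variable {l r : ℤ} {a : ℤ → ℤ} {p k : ℕ}

theorem isUnit_intCast_pow_iff (hk : k ≠ 0) (b : ℤ) :
    IsUnit (b : ZMod (p ^ k)) ↔ Int.gcd b p = 1 := by
  rw [ZMod.coe_int_isUnit_iff_isCoprime, isCoprime_comm, Nat.cast_pow,
    IsCoprime.pow_right_iff (Nat.pos_of_ne_zero hk), Int.isCoprime_iff_gcd_eq_one]

theorem leftIndex_mem (l r : ℤ) (a : ℤ → ℤ) (p : ℕ) : leftIndex l r a p ∈ unitIndices l r a p :=
  Finset.min'_mem _ _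

theorem rightIndex_mem (l r : ℤ) (a : ℤ → ℤ) (p : ℕ) :
    rightIndex l r a p ∈ unitIndices l r a p :=
  Finset.max'_mem _ _

theorem leftIndex_le {j : ℤ} (hj : j ∈ unitIndices l r a p) : leftIndex l r a p ≤ j :=
  Finset.min'_le _ _ hj

theorem le_rightIndex {j : ℤ} (hj : j ∈ unitIndices l r a p) : j ≤ rightIndex l r a p :=
  Finset.le_max' _ _ hj

theorem leftIndex_le_rightIndex (l r : ℤ) (a : ℤ → ℤ) (p : ℕ) :
    leftIndex l r a p ≤ rightIndex l r a p :=
  leftIndex_le (rightIndex_mem l r a p)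

theorem mem_unitIndices {j : ℤ} :
    j ∈ unitIndices l r a p ↔ j = 0 ∨ (j ∈ Finset.Icc l r ∧ Int.gcd (a j) p = 1) := by
  rw [unitIndices, Finset.mem_insert, Finset.mem_filter]

/-- The index `0` is put into `unitIndices` by decree; a permutative variable `j ≤ 0` ensures that
the minimum is nevertheless attained at a genuine unit coefficient. -/
theorem leftIndex_spec (hk : k ≠ 0)
    (h : ∃ j : Finset.Icc l r, (j : ℤ) ≤ 0 ∧ PermutativeIn (localRule (p ^ k) l r a) j) :
    leftIndex l r a p ∈ Finset.Icc l r ∧ IsUnit (a (leftIndex l r a p) : ZMod (p ^ k)) := by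
  obtain ⟨j, hj0, hj⟩ := h
  have hu := isUnit_of_permutativeIn hj
  have hle : leftIndex l r a p ≤ j :=
    leftIndex_le (mem_unitIndices.2 (.inr ⟨j.2, (isUnit_intCast_pow_iff hk _).1 hu⟩))
  rcases mem_unitIndices.1 (leftIndex_mem l r a p) with h0 | ⟨h1, h2⟩
  · have : (j : ℤ) = leftIndex l r a p := by omega
    rw [← this]
    exact ⟨j.2, hu⟩
  · exact ⟨h1, (isUnit_intCast_pow_iff hk _).2 h2⟩

theorem rightIndex_spec (hk : k ≠ 0)
    (h : ∃ j : Finset.Icc l r, 0 ≤ (j : ℤ) ∧ PermutativeIn (localRule (p ^ k) l r a) j) :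
    rightIndex l r a p ∈ Finset.Icc l r ∧ IsUnit (a (rightIndex l r a p) : ZMod (p ^ k)) := by
  obtain ⟨j, hj0, hj⟩ := h
  have hu := isUnit_of_permutativeIn hj
  have hle : j ≤ rightIndex l r a p :=
    le_rightIndex (mem_unitIndices.2 (.inr ⟨j.2, (isUnit_intCast_pow_iff hk _).1 hu⟩))
  rcases mem_unitIndices.1 (rightIndex_mem l r a p) with h0 | ⟨h1, h2⟩
  · have : (j : ℤ) = rightIndex l r a p := by omega
    rw [← this]
    exact ⟨j.2, hu⟩
  · exact ⟨h1, (isUnit_intCast_pow_iff hk _).2 h2⟩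

theorem dvd_of_notMem (hp : p.Prime) (k : ℕ) {j : ℤ} (hj : j ∈ Finset.Icc l r)
    (h : ¬ (leftIndex l r a p ≤ j ∧ j ≤ rightIndex l r a p)) :
    (p : ZMod (p ^ k)) ∣ (a j : ZMod (p ^ k)) := by
  have h1 : Int.gcd (a j) p ≠ 1 := fun h1 => by
    have := mem_unitIndices.2 (.inr ⟨hj, h1⟩ : j = 0 ∨ _)
    exact h ⟨leftIndex_le this, le_rightIndex this⟩
  have h2 : (p : ℤ) ∣ a j := by
    rw [Ne, ← Int.isCoprime_iff_gcd_eq_one, isCoprime_comm] at h1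
    by_contra h3
    exact h1 ((Nat.prime_iff_prime_int.1 hp).coprime_iff_not_dvd.2 h3)
  have := map_dvd (Int.castRingHom (ZMod (p ^ k))) h2
  simpa using this

end Indices

/-! ### Reductions modulo a prime power -/

/-- If `z ≠ 0`, the last nonzero multiple `p ^ i • z` is killed by `p`. On it the coefficients
divisible by `p` act as zero, so both rules have the same orbit and detection for `s'` applies. -/
theorem Detects.of_dvd {R : Type*} [CommRing R] {s s' : Finset ℤ} (hs : s' ⊆ s) {a : ℤ → R}
    {p : R} {k : ℕ} (hp : p ^ k = 0) (ha : ∀ j ∈ s, j ∉ s' → p ∣ a j) {W : Set (ℤ × ℕ)}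
    {J : Finset ℤ} (h : Detects s' a W J) : Detects s a W J := by
  classical
  intro z hz h0
  have hex : ∃ i, p ^ i • z = 0 := ⟨k, by rw [hp, zero_smul]⟩
  rcases hi : Nat.find hex with _ | i
  · simpa [hi] using Nat.find_spec hex
  · have h1 : p ^ (i + 1) • z = 0 := hi ▸ Nat.find_spec hex
    refine absurd (h (p ^ i • z) (fun j hj => ?_) fun q hq => ?_)
      (Nat.find_min hex (by omega : i < Nat.find hex))
    · rw [Pi.smul_apply, hz j hj, smul_zero]
    · rw [← correlation_pow_eq_of_smul_eq_zero s s' hs a p ha q.2 _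
        (by rw [smul_smul, ← pow_succ', h1]), map_smul, Pi.smul_apply, h0 q hq, smul_zero]

theorem natCast_pow_eq_zero (p k : ℕ) : (p : ZMod (p ^ k)) ^ k = 0 := by
  rw [← Nat.cast_pow, ZMod.natCast_self]

section PrimePower

variable {l r : ℤ} {a : ℤ → ℤ} {p k : ℕ} {θ : ℝ}

theorem exists_detects_primePow (hp : p.Prime) (hk : k ≠ 0)
    (hleft : ∃ j : Finset.Icc l r, (j : ℤ) ≤ 0 ∧ PermutativeIn (localRule (p ^ k) l r a) j)
    (hright : ∃ j : Finset.Icc l r, 0 ≤ (j : ℤ) ∧ PermutativeIn (localRule (p ^ k) l r a) j)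
    (hθ : θ ∈ Set.Icc 0 Real.pi) :
    ∃ w₀ C : ℝ, ∀ w ≥ w₀, ∀ T : ℝ, ∃ J : Finset ℤ,
      T * sectorWidth (leftIndex l r a p) (rightIndex l r a p) θ - C ≤ J.card ∧
      Detects (Finset.Icc l r) (fun j => (a j : ZMod (p ^ k))) (window w T θ) J := by
  obtain ⟨hL, hLu⟩ := leftIndex_spec hk hleft
  obtain ⟨hM, hMu⟩ := rightIndex_spec hk hright
  obtain ⟨w₀, C, h⟩ := exists_detects _ _ (leftIndex_le_rightIndex l r a p)
    (fun j => (a j : ZMod (p ^ k))) hLu hMu θ hθ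
  refine ⟨w₀, C, fun w hw T => ?_⟩
  obtain ⟨J, hJ, hJ'⟩ := h w hw T
  refine ⟨J, hJ, hJ'.of_dvd (p := (p : ZMod (p ^ k))) (k := k) ?_ (natCast_pow_eq_zero p k)
    fun j hj hj' => dvd_of_notMem hp k hj fun h' => hj' (Finset.mem_Icc.2 h')⟩
  exact Finset.Icc_subset_Icc (Finset.mem_Icc.1 hL).1 (Finset.mem_Icc.1 hM).2

/-- The configuration on `J` determines the orbit on the `K`-neighbourhood of `W`. -/
def Determines {R : Type*} [CommRing R] (s : Finset ℤ) (a : ℤ → R) (W : Set (ℤ × ℕ)) (K : ℕ)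
    (J : Finset ℤ) : Prop :=
  ∀ z : ℤ → R, (∀ i ∈ J, z i = 0) → ∀ q ∈ W, ∀ i : ℤ, i.natAbs ≤ K →
    (correlation s a ^ q.2) z (i + q.1) = 0

theorem card_Icc_le {A B : ℤ} {x : ℝ} (hx : 0 ≤ x) (h : (B : ℝ) + 1 - A ≤ x) :
    ((Finset.Icc A B).card : ℝ) ≤ x := by
  rw [Int.card_Icc]
  rcases le_total 0 (B + 1 - A) with h1 | h1
  · have h2 : ((B + 1 - A).toNat : ℤ) = B + 1 - A := Int.toNat_of_nonneg h1
    have h3 : ((B + 1 - A).toNat : ℝ) = B + 1 - A := by exact_mod_cast h2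
    rwa [h3]
  · simpa [Int.toNat_of_nonpos h1] using hx

theorem exists_determines_primePow (hp : p.Prime) (k : ℕ)
    (l r : ℤ) (a : ℤ → ℤ) (w : ℝ) (K : ℕ) :
    ∃ C : ℝ, ∀ T ≥ 0, ∃ J : Finset ℤ,
      J.card ≤ T * sectorWidth (leftIndex l r a p) (rightIndex l r a p) θ + C ∧
      Determines (Finset.Icc l r) (fun j => (a j : ZMod (p ^ k))) (window w T θ) K J := by
  set L := leftIndex l r a p with hL
  set M := rightIndex l r a p with hM
  set D : ℤ := |L| + |M| + |l| + |r| with hD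
  set α := Real.cos θ + M * Real.sin θ with hα
  set β := Real.cos θ + L * Real.sin θ with hβ
  have hD0 : 0 ≤ D := by positivity
  have hD0' : (0 : ℝ) ≤ D := by exact_mod_cast hD0
  -- Each end loses `|w|` to the offset, `K` to the neighbourhood and `k * D` to the coefficients
  -- divisible by `p`; `3` covers two roundings and the count of endpoints.
  refine ⟨2 * |w| + 2 * K + 2 * k * D + 3, fun T hT => ?_⟩
  refine ⟨Finset.Icc (⌊-(T * max (-β) 0) - |w| - K - k * D⌋) (⌈T * max α 0 + |w| + K + k * D⌉),
    ?_, fun z hz q hq i hi => ?_⟩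
  · refine card_Icc_le ?_ ?_
    · have : 0 ≤ sectorWidth L M θ := add_nonneg (le_max_right _ _) (le_max_right _ _)
      positivity
    · have h1 := Int.lt_floor_add_one (-(T * max (-β) 0) - |w| - K - k * D)
      have h2 := Int.ceil_lt_add_one (T * max α 0 + |w| + K + k * D)
      rw [sectorWidth, ← hα, ← hβ]
      linarith
  · obtain ⟨x, y, hx1, hx2, hy1, hy2, h1, h2⟩ := hq
    have habsL := abs_le.1 (le_refl |L|)
    have habsM := abs_le.1 (le_refl |M|)
    have habsl := abs_le.1 (le_refl |l|)
    have habsr := abs_le.1 (le_refl |r|)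
    have hw := le_abs_self w
    have hiK : -(K : ℝ) ≤ i ∧ (i : ℝ) ≤ K := by
      constructor
      · have : -(K : ℤ) ≤ i := by omega
        exact_mod_cast this
      · have : i ≤ (K : ℤ) := by omega
        exact_mod_cast this
    refine correlation_pow_eq_zero _ _ (p : ZMod (p ^ k)) L M D hD0
      (fun j hj hj' => dvd_of_notMem hp k hj hj')
      (fun j hj => by rw [Finset.mem_Icc] at hj; omega) q.2 k z
      (by rw [natCast_pow_eq_zero, zero_smul]) _ fun j hj1 hj2 => hz j (Finset.mem_Icc.2 ⟨?_, ?_⟩)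
    · have hj1' : ((i + q.1 + L * q.2 - k * D : ℤ) : ℝ) ≤ j := by exact_mod_cast hj1
      push_cast at hj1'
      rw [h1, h2] at hj1'
      have h3 : y * -β ≤ T * max (-β) 0 :=
        (mul_le_mul_of_nonneg_left (le_max_left _ _) hy1.le).trans
          (mul_le_mul_of_nonneg_right hy2 (le_max_right _ _))
      have h4 : -(T * max (-β) 0) - |w| - K - k * D ≤ j := by
        rw [hβ] at h3 ⊢
        linarith
      exact_mod_cast (Int.floor_le _).trans h4
    · have hj2' : (j : ℝ) ≤ ((i + q.1 + M * q.2 + k * D : ℤ) : ℝ) := by exact_mod_cast hj2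
      push_cast at hj2'
      rw [h1, h2] at hj2'
      have h3 : y * α ≤ T * max α 0 :=
        (mul_le_mul_of_nonneg_left (le_max_left _ _) hy1.le).trans
          (mul_le_mul_of_nonneg_right hy2 (le_max_right _ _))
      have h4 : (j : ℝ) ≤ T * max α 0 + |w| + K + k * D := by
        rw [hα] at h3 ⊢
        linarith
      exact_mod_cast h4.trans (Int.le_ceil _)

end PrimePower

/-! ### The metric -/

section Metric

variable {m : ℕ}

theorem summable_inv_pow_natAbs (hm : 2 ≤ m) :
    Summable fun i : ℤ => (m : ℝ) / (m : ℝ) ^ i.natAbs := by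
  have hm' : (1 : ℝ) < m := by exact_mod_cast hm
  have h : Summable fun n : ℕ => (m : ℝ) / (m : ℝ) ^ n := by
    have := (summable_geometric_of_lt_one (r := (m : ℝ)⁻¹) (by positivity)
      (inv_lt_one_of_one_lt₀ hm')).mul_left (m : ℝ)
    simpa [div_eq_mul_inv] using this
  exact Summable.of_nat_of_neg (by simpa using h) (by simpa using h)

theorem abs_val_sub_le (hm : 2 ≤ m) (b c : ZMod m) : |(b.val : ℝ) - c.val| ≤ m := by
  have : NeZero m := ⟨by omega⟩
  have hb : (b.val : ℝ) < m := by exact_mod_cast ZMod.val_lt b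
  have hc : (c.val : ℝ) < m := by exact_mod_cast ZMod.val_lt c
  have hb0 : (0 : ℝ) ≤ b.val := Nat.cast_nonneg _
  have hc0 : (0 : ℝ) ≤ c.val := Nat.cast_nonneg _
  rw [abs_le]
  constructor <;> linarith

theorem configDist_term_le (hm : 2 ≤ m) (x y : ℤ → ZMod m) (i : ℤ) :
    |((x i).val : ℝ) - ((y i).val : ℝ)| / (m : ℝ) ^ i.natAbs ≤ (m : ℝ) / (m : ℝ) ^ i.natAbs :=
  div_le_div_of_nonneg_right (abs_val_sub_le hm _ _) (by positivity)

theorem summable_configDist (hm : 2 ≤ m) (x y : ℤ → ZMod m) :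
    Summable fun i : ℤ => |((x i).val : ℝ) - ((y i).val : ℝ)| / (m : ℝ) ^ i.natAbs :=
  .of_nonneg_of_le (fun _ => by positivity) (configDist_term_le hm x y)
    (summable_inv_pow_natAbs hm)

theorem one_le_configDist (hm : 2 ≤ m) {x y : ℤ → ZMod m} (h : x 0 ≠ y 0) :
    1 ≤ configDist m x y := by
  have : NeZero m := ⟨by omega⟩
  refine le_trans ?_ ((summable_configDist hm x y).le_tsum 0 fun i _ => by positivity)
  have h1 : ((x 0).val : ℤ) - (y 0).val ≠ 0 := fun h2 =>
    h (ZMod.val_injective m (by omega))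
  have h2 : (1 : ℝ) ≤ |(((x 0).val : ℤ) - ((y 0).val : ℤ) : ℤ)| := by
    exact_mod_cast Int.one_le_abs h1
  simpa using h2

theorem exists_configDist_lt (hm : 2 ≤ m) {ε : ℝ} (hε : 0 < ε) :
    ∃ K : ℕ, ∀ x y : ℤ → ZMod m, (∀ i : ℤ, i.natAbs ≤ K → x i = y i) →
      configDist m x y < ε := by
  have h0 := tendsto_tsum_compl_atTop_zero fun i : ℤ => (m : ℝ) / (m : ℝ) ^ i.natAbs
  obtain ⟨S, hS⟩ := (h0.eventually_lt_const hε).exists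
  refine ⟨S.sup Int.natAbs, fun x y hxy => lt_of_le_of_lt ?_ hS⟩
  have hs := summable_configDist hm x y
  have hzero : ∑ i ∈ S, |((x i).val : ℝ) - ((y i).val : ℝ)| / (m : ℝ) ^ i.natAbs = 0 :=
    Finset.sum_eq_zero fun i hi => by
      rw [hxy i (Finset.le_sup (f := Int.natAbs) hi), sub_self, abs_zero, zero_div]
  rw [configDist, ← hs.sum_add_tsum_subtype_compl S, hzero, zero_add]
  exact (hs.subtype _).tsum_le_tsum (fun i => configDist_term_le hm x y i)
    ((summable_inv_pow_natAbs hm).subtype _)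

end Metric

/-! ### Counting separated sets -/

section Counting

variable {m : ℕ} {l r : ℤ} {a : ℤ → ℤ}

theorem automaton_eq_correlation (m : ℕ) (l r : ℤ) (a : ℤ → ℤ) :
    automaton m l r a = correlation (Finset.Icc l r) (fun j => (a j : ZMod m)) := by
  ext x n
  rw [correlation_apply, ← Finset.sum_coe_sort]
  rfl

theorem action_apply (q : ℤ × ℕ) (x : ℤ → ZMod m) (i : ℤ) :
    action m l r a q x i =
      (correlation (Finset.Icc l r) (fun j => (a j : ZMod m)) ^ q.2) x (i + q.1) := by
  rw [action, automaton_eq_correlation, ← Module.End.pow_apply, correlation_pow_shift]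

/-- The reduction of `ZMod m` modulo the largest power of a prime factor. -/
def reduction (hm : m ≠ 0) (p : m.primeFactors) :
    ZMod m →+* ZMod ((p : ℕ) ^ m.factorization p) :=
  (Pi.evalRingHom _ p).comp (ZMod.equivPi m hm).toRingHom

theorem eq_of_reduction_eq (hm : m ≠ 0) {b c : ZMod m}
    (h : ∀ p, reduction hm p b = reduction hm p c) : b = c :=
  (ZMod.equivPi m hm).injective (funext h)

theorem reduction_correlation (hm : m ≠ 0) (p : m.primeFactors) (t : ℕ) (x : ℤ → ZMod m)
    (n : ℤ) :
    reduction hm p ((correlation (Finset.Icc l r) (fun j => (a j : ZMod m)) ^ t) x n) =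
      (correlation (Finset.Icc l r) (fun j => (a j : ZMod ((p : ℕ) ^ m.factorization p))) ^ t)
        (reduction hm p ∘ x) n := by
  rw [correlation_pow_map]
  have h : reduction hm p ∘ (fun j => (a j : ZMod m)) =
      fun j => (a j : ZMod ((p : ℕ) ^ m.factorization p)) := funext fun j => map_intCast _ _
  rw [h]

theorem card_pi_primeFactors (m : ℕ) (J : ℕ → Finset ℤ) :
    ENat.card (∀ p : m.primeFactors, J p → ZMod ((p : ℕ) ^ m.factorization p)) =
      ((∏ p ∈ m.primeFactors, (p ^ m.factorization p) ^ (J p).card : ℕ) : ℕ∞) := by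
  have : ∀ p : m.primeFactors, NeZero ((p : ℕ) ^ m.factorization p) := fun p =>
    ⟨pow_ne_zero _ (Nat.prime_of_mem_primeFactors p.2).ne_zero⟩
  rw [ENat.card_eq_coe_natCard, Nat.card_pi,
    ← Finset.prod_coe_sort m.primeFactors fun p => (p ^ m.factorization p) ^ (J p).card]
  congr 1
  refine Finset.prod_congr rfl fun p _ => ?_
  rw [Nat.card_fun, Nat.card_zmod, Nat.card_eq_fintype_card, Fintype.card_coe]

/-- Residues on the sets `J p` are injective on a separated set: if they agree, the difference
vanishes near every point of `W`, and the two orbits are never `ε` apart there. -/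
theorem exists_sepNumber_le (hm : 2 ≤ m) (l r : ℤ) (a : ℤ → ℤ) {ε : ℝ} (hε : 0 < ε) :
    ∃ K : ℕ, ∀ (W : Set (ℤ × ℕ)) (J : ℕ → Finset ℤ),
      (∀ p ∈ m.primeFactors, Determines (Finset.Icc l r)
        (fun j => (a j : ZMod (p ^ m.factorization p))) W K (J p)) →
      sepNumber (configDist m) (action m l r a) ε W ≤
        ((∏ p ∈ m.primeFactors, (p ^ m.factorization p) ^ (J p).card : ℕ) : ℕ∞) := by
  have hm0 : m ≠ 0 := by omega
  obtain ⟨K, hK⟩ := exists_configDist_lt hm hε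
  refine ⟨K, fun W J hJ => iSup₂_le fun S hS => ?_⟩
  rw [← card_pi_primeFactors, ← Set.encard_univ]
  refine Set.encard_le_encard_of_injOn
    (f := fun x p (i : J p) => reduction hm0 p (x i)) (fun _ _ => Set.mem_univ _)
    fun x hx y hy hxy => ?_
  by_contra hne
  obtain ⟨q, hq, hd⟩ := hS x hx y hy hne
  refine absurd (hK _ _ fun i hi => ?_) (not_lt.2 hd)
  rw [action_apply, action_apply]
  refine eq_of_reduction_eq hm0 fun p => ?_
  rw [reduction_correlation, reduction_correlation, ← sub_eq_zero, ← Pi.sub_apply, ← map_sub]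
  refine hJ p p.2 _ (fun j hj => ?_) q hq i hi
  exact sub_eq_zero.2 (congrFun (congrFun hxy p) ⟨j, hj⟩)

/-- The configurations with `p`-component supported in `J p` are separated: otherwise two distinct
ones would have orbits agreeing at coordinate `0` throughout `W`, and detection would annihilate
their difference. -/
theorem le_sepNumber (hm : 2 ≤ m) {ε : ℝ} (hε : ε ≤ 1) (W : Set (ℤ × ℕ)) (J : ℕ → Finset ℤ)
    (hJ : ∀ p ∈ m.primeFactors, Detects (Finset.Icc l r)
      (fun j => (a j : ZMod (p ^ m.factorization p))) W (J p)) :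
    ((∏ p ∈ m.primeFactors, (p ^ m.factorization p) ^ (J p).card : ℕ) : ℕ∞) ≤
      sepNumber (configDist m) (action m l r a) ε W := by
  have hm0 : m ≠ 0 := by omega
  let E : (∀ p : m.primeFactors, J p → ZMod ((p : ℕ) ^ m.factorization p)) → ℤ → ZMod m :=
    fun u n => (ZMod.equivPi m hm0).symm fun p => if h : n ∈ J p then u p ⟨n, h⟩ else 0
  have hE : ∀ u p n, reduction hm0 p (E u n) = if h : n ∈ J p then u p ⟨n, h⟩ else 0 :=
    fun u p n => congrFun ((ZMod.equivPi m hm0).apply_symm_apply _) p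
  have hinj : Function.Injective E := fun u v huv => by
    ext p ⟨n, hn⟩
    have := hE u p n
    rw [huv, hE v p n, dif_pos hn, dif_pos hn] at this
    exact this.symm
  rw [← card_pi_primeFactors]
  refine hinj.encard_range.trans (le_iSup₂_of_le (Set.range E) ?_ le_rfl)
  rintro _ ⟨u, rfl⟩ _ ⟨v, rfl⟩ hne
  by_contra! hd
  refine hne (funext fun n => eq_of_reduction_eq hm0 fun p => ?_)
  have hz := hJ p p.2 (reduction hm0 p ∘ E u - reduction hm0 p ∘ E v) (fun i hi => by
    simp [hE, hi]) fun q hq => by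
      have h1 : action m l r a q (E u) 0 = action m l r a q (E v) 0 := by
        by_contra h
        exact absurd (one_le_configDist hm h) (not_le.2 ((hd q hq).trans_le hε))
      rw [action_apply, action_apply, zero_add] at h1
      rw [map_sub, Pi.sub_apply, ← reduction_correlation, ← reduction_correlation, h1, sub_self]
  exact sub_eq_zero.1 (congrFun hz n)

end Counting

/-! ### The entropy -/

section Entropy

variable {m : ℕ} {l r : ℤ} {a : ℤ → ℤ} {θ : ℝ}

theorem log_natCast {n : ℕ} (hn : n ≠ 0) :
    ENNReal.log (((n : ℕ∞) : ENNReal)) = ((Real.log n : ℝ) : EReal) := by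
  rw [ENat.toENNReal_coe, ENNReal.log_pos_real (by exact_mod_cast hn) (ENNReal.natCast_ne_top n),
    ENNReal.toReal_natCast]

theorem log_prod_pow (m : ℕ) (c : ℕ → ℕ) :
    Real.log ((∏ p ∈ m.primeFactors, (p ^ m.factorization p) ^ c p : ℕ) : ℝ) =
      ∑ p ∈ m.primeFactors, (m.factorization p : ℝ) * c p * Real.log p := by
  rw [Nat.cast_prod, Real.log_prod]
  · refine Finset.sum_congr rfl fun p _ => ?_
    rw [Nat.cast_pow, Nat.cast_pow, Real.log_pow, Real.log_pow]
    ring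
  · intro p hp
    have := (Nat.prime_of_mem_primeFactors hp).ne_zero
    positivity

theorem prod_pow_ne_zero (m : ℕ) (c : ℕ → ℕ) :
    ∏ p ∈ m.primeFactors, (p ^ m.factorization p) ^ c p ≠ 0 :=
  Finset.prod_ne_zero_iff.2 fun _ hp =>
    pow_ne_zero _ (pow_ne_zero _ (Nat.prime_of_mem_primeFactors hp).ne_zero)

theorem coe_sum_ereal {ι : Type*} (s : Finset ι) (f : ι → ℝ) :
    ((∑ i ∈ s, f i : ℝ) : EReal) = ∑ i ∈ s, (f i : EReal) :=
  map_sum (⟨⟨Real.toEReal, EReal.coe_zero⟩, EReal.coe_add⟩ : ℝ →+ EReal) f s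

/-- The entropy is determined by linear bounds, up to a constant, on the numbers of positions that
are detected and that determine the orbit. -/
theorem dirEntropy_eq_of_bounds (hm : 2 ≤ m) (G : ℕ → ℝ)
    (hlow : ∀ p ∈ m.primeFactors, ∃ w₀ C : ℝ, ∀ w ≥ w₀, ∀ T : ℝ, ∃ J : Finset ℤ,
      T * G p - C ≤ J.card ∧
      Detects (Finset.Icc l r) (fun j => (a j : ZMod (p ^ m.factorization p))) (window w T θ) J)
    (hupp : ∀ p ∈ m.primeFactors, ∀ (w : ℝ) (K : ℕ), ∃ C : ℝ, ∀ T ≥ 0, ∃ J : Finset ℤ,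
      J.card ≤ T * G p + C ∧ Determines (Finset.Icc l r)
        (fun j => (a j : ZMod (p ^ m.factorization p))) (window w T θ) K J) :
    dirEntropy m l r a θ =
      ((∑ p ∈ m.primeFactors, (m.factorization p : ℝ) * G p * Real.log p : ℝ) : EReal) := by
  set S : ℝ := ∑ p ∈ m.primeFactors, (m.factorization p : ℝ) * G p * Real.log p with hS
  choose! w₀ C hlow using hlow
  choose! C' hupp using hupp
  have hw₀ : ∀ᶠ w : ℝ in atTop, ∀ p ∈ m.primeFactors, w₀ p ≤ w :=
    (Finset.eventually_all _).2 fun p _ => eventually_ge_atTop _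
  have hlim : ∀ D : ℝ, Tendsto (fun T : ℝ => (((T * S + D) / T : ℝ) : EReal)) atTop
      (𝓝 (S : EReal)) := by
    intro D
    refine (continuous_coe_real_ereal.tendsto S).comp ?_
    have h1 : Tendsto (fun T : ℝ => S + D / T) atTop (𝓝 (S + 0)) :=
      tendsto_const_nhds.add (tendsto_const_nhds.div_atTop tendsto_id)
    rw [add_zero] at h1
    refine h1.congr' ?_
    filter_upwards [eventually_gt_atTop 0] with T hT
    field_simp
  -- The limit in `T` does not depend on `ε ≤ 1` or on large `w`, so the two outer upper limits are
  -- taken of eventually constant functions.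
  have main : ∀ ε : ℝ, 0 < ε → ε ≤ 1 → ∀ w : ℝ, (∀ p ∈ m.primeFactors, w₀ p ≤ w) →
      Tendsto (fun T : ℝ => ENNReal.log ((sepNumber (configDist m) (action m l r a) ε
        (window w T θ) : ℕ∞) : ENNReal) / (T : EReal)) atTop (𝓝 (S : EReal)) := by
    intro ε hε hε1 w hw
    obtain ⟨K, hK⟩ := exists_sepNumber_le hm l r a hε
    set D := ∑ p ∈ m.primeFactors, (m.factorization p : ℝ) * -C p * Real.log p with hD
    set D' := ∑ p ∈ m.primeFactors, (m.factorization p : ℝ) * C' p w K * Real.log p with hD'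
    have hsum : ∀ (T : ℝ) (c : ℕ → ℝ), T * S +
        ∑ p ∈ m.primeFactors, (m.factorization p : ℝ) * c p * Real.log p =
        ∑ p ∈ m.primeFactors, (m.factorization p : ℝ) * (T * G p + c p) * Real.log p := by
      intro T c
      rw [hS, Finset.mul_sum, ← Finset.sum_add_distrib]
      exact Finset.sum_congr rfl fun p _ => by ring
    refine tendsto_of_tendsto_of_tendsto_of_le_of_le' (hlim D) (hlim D') ?_ ?_
    · filter_upwards [eventually_gt_atTop 0] with T hT
      choose! J hJ hJ' using fun p hp => hlow p hp w (hw p hp) T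
      rw [EReal.coe_div]
      refine EReal.div_le_div_right_of_nonneg (by exact_mod_cast hT.le) ?_
      refine le_trans ?_ (ENNReal.log_monotone
        (ENat.toENNReal_mono (le_sepNumber hm hε1 (window w T θ) J hJ')))
      rw [log_natCast (prod_pow_ne_zero m _), log_prod_pow, EReal.coe_le_coe_iff, hD, hsum]
      refine Finset.sum_le_sum fun p hp => ?_
      have := hJ p hp
      gcongr
      linarith
    · filter_upwards [eventually_gt_atTop 0] with T hT
      choose! J hJ hJ' using fun p hp => hupp p hp w K T hT.le
      rw [EReal.coe_div]
      refine EReal.div_le_div_right_of_nonneg (by exact_mod_cast hT.le) ?_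
      refine (ENNReal.log_monotone (ENat.toENNReal_mono (hK (window w T θ) J hJ'))).trans ?_
      rw [log_natCast (prod_pow_ne_zero m _), log_prod_pow, EReal.coe_le_coe_iff, hD', hsum]
      refine Finset.sum_le_sum fun p hp => ?_
      have := hJ p hp
      gcongr
  have hw : ∀ ε : ℝ, 0 < ε → ε ≤ 1 → limsup (fun w : ℝ => limsup (fun T : ℝ =>
      ENNReal.log ((sepNumber (configDist m) (action m l r a) ε (window w T θ) : ℕ∞) : ENNReal) /
        (T : EReal)) atTop) atTop = S := fun ε hε hε1 =>
    Tendsto.limsup_eq (tendsto_const_nhds.congr' (hw₀.mono fun w hw =>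
      (main ε hε hε1 w hw).limsup_eq.symm))
  refine Tendsto.limsup_eq (tendsto_const_nhds.congr' ?_)
  filter_upwards [Ioc_mem_nhdsGT one_pos] with ε hε
  exact (hw ε hε.1 hε.2).symm

theorem dirEntropy_eq_sum_sectorWidth (hm : 2 ≤ m)
    (hleft : ∀ p ∈ m.primeFactors, ∃ j : Finset.Icc l r, (j : ℤ) ≤ 0 ∧
      PermutativeIn (localRule (p ^ m.factorization p) l r a) j)
    (hright : ∀ p ∈ m.primeFactors, ∃ j : Finset.Icc l r, 0 ≤ (j : ℤ) ∧
      PermutativeIn (localRule (p ^ m.factorization p) l r a) j)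
    (hθ : θ ∈ Set.Icc 0 Real.pi) :
    dirEntropy m l r a θ = ((∑ p ∈ m.primeFactors, (m.factorization p : ℝ) *
      sectorWidth (leftIndex l r a p) (rightIndex l r a p) θ * Real.log p : ℝ) : EReal) := by
  refine dirEntropy_eq_of_bounds hm _ (fun p hp => ?_) fun p hp => ?_
  · exact exists_detects_primePow (Nat.prime_of_mem_primeFactors hp)
      (Nat.Prime.factorization_pos_of_dvd (Nat.prime_of_mem_primeFactors hp) (by omega)
        (Nat.dvd_of_mem_primeFactors hp)).ne' (hleft p hp) (hright p hp) hθ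
  · exact exists_determines_primePow (Nat.prime_of_mem_primeFactors hp) _ l r a

end Entropy

end LCA

end

theorem theorem4p4 (m : ℕ) (hm : 2 ≤ m) (l r : ℤ) (a : ℤ → ℤ)
    (hleft : ∀ p ∈ m.primeFactors, ∃ j : Finset.Icc l r, (j : ℤ) ≤ 0 ∧
      LCA.PermutativeIn (LCA.localRule (p ^ m.factorization p) l r a) j)
    (hright : ∀ p ∈ m.primeFactors, ∃ j : Finset.Icc l r, 0 ≤ (j : ℤ) ∧
      LCA.PermutativeIn (LCA.localRule (p ^ m.factorization p) l r a) j)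
    (θ : ℝ) (hθ : θ ∈ Set.Icc 0 Real.pi) :
    -- the entropy is the sum of the entropies of the reductions
    LCA.dirEntropy m l r a θ =
        ∑ p ∈ m.primeFactors, LCA.dirEntropy (p ^ m.factorization p) l r a θ ∧
    -- explicit value, as a sum of three-piece functions
    LCA.dirEntropy m l r a θ =
        ((∑ p ∈ m.primeFactors, LCA.sectorTerm p (m.factorization p)
          (LCA.leftIndex l r a p) (LCA.rightIndex l r a p) θ : ℝ) : EReal) ∧
    -- the same value written out on each closed sector cut out by the angles `θ_L` and `θ_R`
    ∀ A B C : Finset ℕ, Disjoint A B → Disjoint (A ∪ B) C → A ∪ B ∪ C = m.primeFactors →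
      (∀ p ∈ A, θ ≤ LCA.arccot (-(LCA.leftIndex l r a p : ℝ))) →
      (∀ p ∈ B, LCA.arccot (-(LCA.leftIndex l r a p : ℝ)) ≤ θ ∧
        θ ≤ LCA.arccot (-(LCA.rightIndex l r a p : ℝ))) →
      (∀ p ∈ C, LCA.arccot (-(LCA.rightIndex l r a p : ℝ)) ≤ θ) →
      LCA.dirEntropy m l r a θ =
        ((∑ p ∈ A, (m.factorization p : ℝ) *
              |Real.cos θ + (LCA.rightIndex l r a p : ℝ) * Real.sin θ| * Real.log (p : ℝ) +
          ∑ p ∈ B, (m.factorization p : ℝ) *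
              |((LCA.rightIndex l r a p : ℝ) - (LCA.leftIndex l r a p : ℝ)) * Real.sin θ| *
                Real.log (p : ℝ) +
          ∑ p ∈ C, (m.factorization p : ℝ) *
              |Real.cos θ + (LCA.leftIndex l r a p : ℝ) * Real.sin θ| * Real.log (p : ℝ) : ℝ) :
          EReal) := by
  have hLM := fun p => LCA.leftIndex_le_rightIndex l r a p
  have hmain := LCA.dirEntropy_eq_sum_sectorWidth hm hleft hright hθ
  refine ⟨?_, ?_, fun A B C hAB hABC hunion hA hB hC => ?_⟩
  -- The same formula applies to the modulus `p ^ m.factorization p`: its only prime factor is `p`,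
  -- and the extreme indices depend on the modulus through `p` alone.
  · rw [hmain, LCA.coe_sum_ereal]
    refine Finset.sum_congr rfl fun p hp => ?_
    have hpp := Nat.prime_of_mem_primeFactors hp
    have hk : m.factorization p ≠ 0 :=
      (hpp.factorization_pos_of_dvd (by omega) (Nat.dvd_of_mem_primeFactors hp)).ne'
    have hfac : (p ^ m.factorization p).factorization p = m.factorization p := by
      simp [hpp.factorization_pow]
    have h1 : (p ^ m.factorization p).primeFactors = {p} :=
      Nat.primeFactors_prime_pow hk hpp
    rw [LCA.dirEntropy_eq_sum_sectorWidth (hpp.two_le.trans (Nat.le_self_pow hk p)) ?_ ?_ hθ,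
      h1, Finset.sum_singleton, hfac]
    · intro q hq
      rw [h1, Finset.mem_singleton] at hq
      rw [hq, hfac]
      exact hleft p hp
    · intro q hq
      rw [h1, Finset.mem_singleton] at hq
      rw [hq, hfac]
      exact hright p hp
  · rw [hmain]
    congr 1
    exact Finset.sum_congr rfl fun p _ => (LCA.sectorTerm_eq (hLM p) hθ p _).symm
  · rw [hmain, ← hunion, Finset.sum_union hABC, Finset.sum_union hAB]
    congr 1
    congr 1
    · congr 1
      · exact Finset.sum_congr rfl fun p hp => by
          rw [LCA.sectorWidth_of_le_left (hLM p) hθ (hA p hp)]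
      · exact Finset.sum_congr rfl fun p hp => by
          rw [LCA.sectorWidth_of_mid hθ (hB p hp).1 (hB p hp).2]
    · exact Finset.sum_congr rfl fun p hp => by
        rw [LCA.sectorWidth_of_right_le (hLM p) hθ (hC p hp)]
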